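/- Let $G$ be a diffeological group with identity $e$. For a diffeological space $X$, the tangent space $T_xX$ is the internal one: the colimit, in real vector spaces, of the spaces $T_0U$ over all plots $p\colon U\to X$ with $p(0)=x$ ($0\in U$, $U$ a connected open subset of a Euclidean space). The tangent bundle $TX=\bigsqcup_x T_xX$ carries the smallest diffeology for which it is a vector pseudo-bundle over $X$ (projection, fibrewise addition, scalar multiplication and zero section smooth) and all the induced maps $Tp\colon TU\to TX$, $p$ a plot, are smooth. Let $S_G\subseteq[0,1]^{\mathbb N}\times G^{\mathbb N}$ be the set of all $(t_i,g_i)_{i\in\mathbb N}$ such that only finitely many $t_i$ are nonzero and $\sum_i t_i=1$, with the subset diffeology of the product diffeology. Let $EG$ be the quotient of $S_G$, with the quotient diffeology, in which $(t_i,g_i)$ and $(t_i',g_i')$ are identified if $t_i=t_i'$ for all $i$, and $g_i=g_i'$ whenever $t_i\neq0$. Let $\rho\colon S_G\to EG$ be the quotient map and write $(t_ig_i)=\rho((t_i,g_i))$. Let $G$ act on $EG$ by $h\cdot(t_ig_i)=(t_ig_ih^{-1})$, and let $\pi\colon EG\to BG=EG/G$ be the quotient map, $BG$ carrying the quotient diffeology.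 Then $\pi\colon EG\to BG$ is a diffeological principal $G$-bundle, and it admits a connection 1-form, that is, a smooth fibrewise linear map $\omega\colon T(EG)\to T_eG$ that is $G$-equivariant (with respect to the adjoint action on $T_eG$) and satisfies $\omega(\xi_{EG}|_y)=\xi$ for all $y\in EG$ and $\xi\in T_eG$, where $\xi_{EG}|_y=\frac{d}{dt}\big|_{t=0}\,g(t)\cdot y$ for any smooth curve $g$ in $G$ with $g(0)=e$ and $\dot g(0)=\xi$. Moreover, $\omega$ can be obtained by descending a weighted sum of Maurer–Cartan forms from $S_G$ to $EG$: there are smooth functions $\varphi_i\colon BG\to[0,\infty)$, $i\in\mathbb N$, with $\sum_i\varphi_i=1$ pointwise and $\varphi_i(\pi(t_jg_j))=0$ whenever $t_i=0$, such that $$\rho^*\omega=-\sum_{i\in\mathbb N}(\varphi_i\circ\pi\circ\rho)\,\mathrm{pr}_i^*\alpha,$$ where $\alpha\colon TG\to T_eG$, $\alpha(v)=(L_{g^{-1}})_*v$ for $v\in T_gG$, is the Maurer–Cartan form and $\mathrm{pr}_i\colon S_G\to G$ is $(t_j,g_j)\mapsto g_i$. -/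

import Mathlib

open Diffeology Set
open scoped DirectSum

noncomputable section

namespace MilnorDiffeology

universe u v

/-- The Euclidean space `ℝⁿ`, the domain of the plots of a diffeological space. -/
abbrev Euc (n : ℕ) : Type := EuclideanSpace ℝ (Fin n)

/-! ### Subset, product and quotient diffeologies -/

section Constructions

open scoped ContDiff

variable {X : Type u} {Y : Type v}

/-- The pullback diffeology along `f`: a map `p` is a plot iff `f ∘ p` is a plot. -/
@[reducible]
def inducedDiffeology (f : X → Y) (d : DiffeologicalSpace Y) : DiffeologicalSpace X where
  plots n := {p | f ∘ p ∈ d.plots n}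
  constant_plots x := d.constant_plots (f x)
  plot_reparam hp hf := d.plot_reparam (p := _) hp hf
  locality {n p} h := d.locality (p := f ∘ p) fun x => by
    obtain ⟨u, hu, hxu, H⟩ := h x
    exact ⟨u, hu, hxu, fun {m g} hg hg' => H hg hg'⟩

/-- The subset diffeology. -/
instance subtypeDiffeology [d : DiffeologicalSpace X] (s : X → Prop) :
    DiffeologicalSpace {x // s x} :=
  inducedDiffeology Subtype.val d

/-- The product diffeology on a binary product. -/
instance prodDiffeology [dX : DiffeologicalSpace X] [dY : DiffeologicalSpace Y] :
    DiffeologicalSpace (X × Y) :=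
  inducedDiffeology Prod.fst dX ⊓ inducedDiffeology Prod.snd dY

/-- The product diffeology on an arbitrary product. -/
instance piDiffeology {ι : Type u} {Z : ι → Type v} [d : ∀ i, DiffeologicalSpace (Z i)] :
    DiffeologicalSpace (∀ i, Z i) :=
  ⨅ i, inducedDiffeology (fun z : ∀ i, Z i => z i) (d i)

theorem isPlot_induced_iff (f : X → Y) (d : DiffeologicalSpace Y) {n : ℕ} {p : Euc n → X} :
    (@IsPlot X (inducedDiffeology f d) n p) ↔ IsPlot (f ∘ p) := Iff.rfl

theorem isPlot_subtype_iff [DiffeologicalSpace X] {s : X → Prop} {n : ℕ}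
    {p : Euc n → {x // s x}} : IsPlot p ↔ IsPlot (fun y => (p y : X)) := Iff.rfl

theorem isPlot_prod_iff [DiffeologicalSpace X] [DiffeologicalSpace Y] {n : ℕ}
    {p : Euc n → X × Y} :
    IsPlot p ↔ IsPlot (fun y => (p y).1) ∧ IsPlot (fun y => (p y).2) :=
  DiffeologicalSpace.isPlot_inf_iff

theorem isPlot_pi_iff {ι : Type u} {Z : ι → Type v} [∀ i, DiffeologicalSpace (Z i)] {n : ℕ}
    {p : Euc n → ∀ i, Z i} : IsPlot p ↔ ∀ i, IsPlot (fun y => p y i) :=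
  DiffeologicalSpace.isPlot_iInf_iff

/-- Near any point, an open subset of `ℝⁿ` receives a smooth map from all of `ℝⁿ` which is the
identity near that point. -/
theorem exists_localizing {n : ℕ} {U : Set (Euc n)} (hU : IsOpen U) {x : Euc n} (hx : x ∈ U) :
    ∃ f : Euc n → Euc n, ContDiff ℝ ∞ f ∧ (∀ y, f y ∈ U) ∧
      ∃ W : Set (Euc n), IsOpen W ∧ x ∈ W ∧ ∀ y ∈ W, f y = y := by
  obtain ⟨ε, hε, hε'⟩ := Metric.isOpen_iff.mp hU x hx
  let χ : ContDiffBump x := ⟨ε / 4, ε / 2, by positivity, by linarith⟩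
  refine ⟨fun y => x + χ y • (y - x), ?_, ?_, Metric.ball x (ε / 4), Metric.isOpen_ball,
    Metric.mem_ball_self (by positivity), ?_⟩
  · exact contDiff_const.add (χ.contDiff.smul (contDiff_id.sub contDiff_const))
  · intro y
    apply hε'
    rw [Metric.mem_ball, dist_eq_norm, add_sub_cancel_left, norm_smul, Real.norm_eq_abs,
      abs_of_nonneg χ.nonneg]
    by_cases hy : y ∈ Metric.ball x (ε / 2)
    · rw [Metric.mem_ball, dist_eq_norm] at hy
      have h1 : χ y ≤ 1 := χ.le_one
      nlinarith [norm_nonneg (y - x)]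
    · have h0 : χ y = 0 := by
        by_contra h
        have : y ∈ Function.support χ := h
        rw [χ.support_eq] at this
        exact hy this
      simpa [h0] using hε
  · intro y hy
    have h1 : χ y = 1 := χ.one_of_mem_closedBall (Metric.ball_subset_closedBall hy)
    simp [h1]

/-- The quotient diffeology along a surjection `f`: a map is a plot iff it lifts locally along
`f` to plots. -/
@[reducible]
def quotientDiffeology (d : DiffeologicalSpace X) (f : X → Y) (hf : Function.Surjective f) :
    DiffeologicalSpace Y where
  plots n := {p | ∀ x : Euc n, ∃ U : Set (Euc n), IsOpen U ∧ x ∈ U ∧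
    ∃ q : Euc n → X, IsPlot q ∧ ∀ y ∈ U, f (q y) = p y}
  constant_plots y x := by
    obtain ⟨z, rfl⟩ := hf y
    exact ⟨univ, isOpen_univ, mem_univ _, fun _ => z, isPlot_const, fun _ _ => rfl⟩
  plot_reparam {n m p g} hp hg x := by
    obtain ⟨U, hU, hxU, q, hq, h⟩ := hp (g x)
    exact ⟨g ⁻¹' U, hU.preimage hg.continuous, hxU, q ∘ g, isPlot_reparam hq hg,
      fun y hy => h (g y) hy⟩
  locality {n p} hp x := by
    obtain ⟨U, hU, hxU, H⟩ := hp x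
    obtain ⟨g, hg, hgU, W, hW, hxW, hgW⟩ := exists_localizing hU hxU
    obtain ⟨V, hV, hxV, q, hq, h⟩ := H hgU hg x
    refine ⟨V ∩ W, hV.inter hW, ⟨hxV, hxW⟩, q, hq, fun y hy => ?_⟩
    rw [h y hy.1, Function.comp_apply, hgW y hy.2]

end Constructions

/-! ### The internal tangent bundle -/

section Tangent

open scoped ContDiff

variable {X : Type u} [DiffeologicalSpace X] {Y : Type v} [DiffeologicalSpace Y]

/-- A plot of `X` centred at `x`. Plots defined on all of `ℝⁿ` suffice: a plot defined on a
neighbourhood of `0` coincides near `0` with a plot defined on `ℝⁿ`. -/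
structure PointedPlot (x : X) where
  dim : ℕ
  toFun : Euc dim → X
  isPlot : IsPlot toFun
  map_zero : toFun 0 = x

open Classical in
/-- The relations imposed by the arrows between centred plots: if `q ∘ f = p` with `f` smooth and
`f 0 = 0`, then `v` in the copy of `T₀ℝⁿ` at `p` is identified with `f_* v` in that at `q`. -/
def tangentRelations (x : X) : Submodule ℝ (⨁ p : PointedPlot x, Euc p.dim) :=
  Submodule.span ℝ {z | ∃ (p q : PointedPlot x) (f : Euc p.dim → Euc q.dim) (v : Euc p.dim),
    ContDiff ℝ ∞ f ∧ f 0 = 0 ∧ q.toFun ∘ f = p.toFun ∧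
    z = DirectSum.lof ℝ (PointedPlot x) (fun p => Euc p.dim) p v -
      DirectSum.lof ℝ (PointedPlot x) (fun p => Euc p.dim) q (fderiv ℝ f 0 v)}

/-- The internal tangent space `T_x X`: the colimit, in real vector spaces, of the spaces `T₀ℝⁿ`
over the category of plots centred at `x`. -/
def TSpace (x : X) : Type u := (⨁ p : PointedPlot x, Euc p.dim) ⧸ tangentRelations x

instance (x : X) : AddCommGroup (TSpace x) :=
  inferInstanceAs (AddCommGroup ((⨁ p : PointedPlot x, Euc p.dim) ⧸ tangentRelations x))

instance (x : X) : Module ℝ (TSpace x) :=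
  inferInstanceAs (Module ℝ ((⨁ p : PointedPlot x, Euc p.dim) ⧸ tangentRelations x))

open Classical in
/-- The structure map `p_* : T₀ℝⁿ → T_x X` of the colimit. -/
def PointedPlot.push {x : X} (p : PointedPlot x) : Euc p.dim →ₗ[ℝ] TSpace x :=
  (tangentRelations x).mkQ ∘ₗ DirectSum.lof ℝ (PointedPlot x) (fun p => Euc p.dim) p

theorem PointedPlot.push_fderiv {x : X} (p q : PointedPlot x) (f : Euc p.dim → Euc q.dim)
    (hf : ContDiff ℝ ∞ f) (h0 : f 0 = 0) (hfq : q.toFun ∘ f = p.toFun) (v : Euc p.dim) :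
    q.push (fderiv ℝ f 0 v) = p.push v := by
  refine ((Submodule.Quotient.eq (tangentRelations x)).mpr ?_).symm
  exact Submodule.subset_span ⟨p, q, f, v, hf, h0, hfq, rfl⟩

/-- The image of a centred plot under a smooth map. -/
@[reducible]
def PointedPlot.map {x : X} (p : PointedPlot x) {f : X → Y} (hf : DSmooth f) {y : Y}
    (hy : f x = y) : PointedPlot y where
  dim := p.dim
  toFun := f ∘ p.toFun
  isPlot := hf _ _ p.isPlot
  map_zero := by rw [Function.comp_apply, p.map_zero, hy]

open Classical in
/-- The tangent map `f_* : T_x X → T_y Y` of a smooth map `f` with `f x = y`; it sends `p_* v` to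
`(f ∘ p)_* v`. -/
def pushforward {f : X → Y} (hf : DSmooth f) {x : X} {y : Y} (hy : f x = y) :
    TSpace x →ₗ[ℝ] TSpace y :=
  (tangentRelations x).liftQ
    (DirectSum.toModule ℝ (PointedPlot x) (TSpace y) fun p => (p.map hf hy).push) <| by
      refine Submodule.span_le.mpr ?_
      rintro _ ⟨p, q, g, v, hg, hg0, hgq, rfl⟩
      rw [SetLike.mem_coe, LinearMap.mem_ker, map_sub, DirectSum.toModule_lof,
        DirectSum.toModule_lof, sub_eq_zero]
      exact (PointedPlot.push_fderiv (p.map hf hy) (q.map hf hy) g hg hg0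
        (by simp only [PointedPlot.map]; rw [Function.comp_assoc, hgq]) v).symm

open Classical in
theorem pushforward_push {f : X → Y} (hf : DSmooth f) {x : X} {y : Y} (hy : f x = y)
    (p : PointedPlot x) (v : Euc p.dim) :
    pushforward hf hy (p.push v) = (p.map hf hy).push v :=
  (Submodule.liftQ_apply _ _ _).trans (DirectSum.toModule_lof _ _ _)

/-- The set underlying the internal tangent bundle `TX`. -/
def TBundle (X : Type u) [DiffeologicalSpace X] : Type u := Σ x : X, TSpace x

/-- The translate `y ↦ p (a + y)` of a plot, centred at `p a`. -/
@[reducible]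
def PointedPlot.translate {n : ℕ} {p : Euc n → X} (hp : IsPlot p) (a : Euc n) :
    PointedPlot (p a) where
  dim := n
  toFun := fun y => p (a + y)
  isPlot := isPlot_reparam hp (contDiff_const.add contDiff_id)
  map_zero := by rw [add_zero]

/-- The map `Tp : Tℝⁿ = ℝⁿ × ℝⁿ → TX` induced by a plot `p`. -/
def plotTangent {n : ℕ} {p : Euc n → X} (hp : IsPlot p) (z : Euc n × Euc n) : TBundle X :=
  ⟨p z.1, (PointedPlot.translate hp z.1).push z.2⟩

/-- A diffeology on `TX` makes `TX → X` a vector pseudo-bundle: the projection, fibrewise addition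
on `TX ×_X TX`, scalar multiplication on `ℝ × TX` and the zero section are smooth. (A plot of
`TX ×_X TX` is a pair of plots of `TX` over the same map into `X`. That every fibre is a
diffeological vector space for the subset diffeology follows.) -/
structure IsVectorPseudoBundle (d : DiffeologicalSpace (TBundle X)) : Prop where
  smooth_proj : @DSmooth (TBundle X) X d _ (fun z => z.1)
  smooth_add : ∀ {n : ℕ} (x : Euc n → X) (v w : ∀ a, TSpace (x a)),
    @IsPlot (TBundle X) d n (fun a => ⟨x a, v a⟩) →
    @IsPlot (TBundle X) d n (fun a => ⟨x a, w a⟩) →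
    @IsPlot (TBundle X) d n (fun a => ⟨x a, v a + w a⟩)
  smooth_smul : ∀ {n : ℕ} (r : Euc n → ℝ) (x : Euc n → X) (v : ∀ a, TSpace (x a)),
    IsPlot r → @IsPlot (TBundle X) d n (fun a => ⟨x a, v a⟩) →
    @IsPlot (TBundle X) d n (fun a => ⟨x a, r a • v a⟩)
  smooth_zero : @DSmooth X (TBundle X) _ d (fun x => ⟨x, 0⟩)

/-- The diffeology of the internal tangent bundle: the smallest one for which `TX` is a vector
pseudo-bundle and all maps `Tp`, for `p` a plot of `X`, are smooth. -/
instance : DiffeologicalSpace (TBundle X) :=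
  sInf {d | IsVectorPseudoBundle d ∧
    ∀ {n : ℕ} {p : Euc n → X} (hp : IsPlot p), @DSmooth (Euc n × Euc n) (TBundle X) _ d (plotTangent hp)}

/-- The fibre `T_x X` carries the subset diffeology from `TX`. -/
instance (x : X) : DiffeologicalSpace (TSpace x) :=
  inducedDiffeology (fun v : TSpace x => (⟨x, v⟩ : TBundle X))
    (inferInstance : DiffeologicalSpace (TBundle X))

/-- The velocity at time `t` of a smooth curve `c` with `c t = x`. -/
def velocity {c : ℝ → X} (hc : DSmooth c) (t : ℝ) {x : X} (hx : c t = x) : TSpace x :=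
  PointedPlot.push
    { dim := 1
      toFun := fun y => c (t + y 0)
      isPlot := by
        have h : ContDiff ℝ ∞ (fun y : Euc 1 => t + y 0) := by fun_prop
        exact hc _ _ h.isPlot
      map_zero := by simpa using hx }
    (EuclideanSpace.single 0 1)

/-- Velocities are natural. -/
theorem pushforward_velocity {f : X → Y} (hf : DSmooth f) {c : ℝ → X} (hc : DSmooth c) (t : ℝ)
    {x : X} (hx : c t = x) {y : Y} (hy : f x = y) :
    pushforward hf hy (velocity hc t hx) = velocity (hf.comp hc) t (by simp [hx, hy]) :=
  pushforward_push _ _ _ _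

end Tangent

/-! ### Diffeological groups, principal bundles and connection 1-forms -/

section Groups

/-- A diffeological group. -/
class DiffeologicalGroup (G : Type u) [Group G] [DiffeologicalSpace G] : Prop where
  smooth_mul : DSmooth (fun z : G × G => z.1 * z.2)
  smooth_inv : DSmooth (fun g : G => g⁻¹)

variable {G : Type u} [Group G] [DiffeologicalSpace G]

variable {E : Type v} [DiffeologicalSpace E] [MulAction G E]
  {B : Type v} [DiffeologicalSpace B]

variable (G) in
/-- `π : E → B` is a principal `G`-bundle: a smooth surjection together with a smooth action of `G`
on `E` such that the pullback along every plot `p` of the base is locally equivariantly trivial: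
near every point of its domain, `p` has a smooth lift `q` on an open set `V` such that
`(x, g) ↦ (x, g • q x)` is a diffeomorphism from `V × G` to the pullback of `E` to `V`. (In
particular `π` is a diffeological fibre bundle with fibre `G`.) -/
structure IsPrincipalBundle (π : E → B) : Prop where
  smooth_proj : DSmooth π
  surjective_proj : Function.Surjective π
  smooth_smul : DSmooth (fun z : G × E => z.1 • z.2)
  locally_trivial : ∀ {n : ℕ} (p : Euc n → B), IsPlot p → ∀ a : Euc n,
    ∃ V : Set (Euc n), IsOpen V ∧ a ∈ V ∧ ∃ q : V → E, DSmooth q ∧ (∀ x : V, π (q x) = p x) ∧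
      ∃ ψ : V × G ≃ {z : V × E // p z.1 = π z.2}, DSmooth ψ ∧ DSmooth ψ.symm ∧
        ∀ (x : V) (g : G), (ψ (x, g)).1 = (x, g • q x)

variable {π : E → B}

theorem IsPrincipalBundle.smooth_act (hπ : IsPrincipalBundle G π) (g : G) :
    DSmooth (fun y : E => g • y) := fun _ p hp =>
  hπ.smooth_smul _ (fun a => (g, p a)) (isPlot_prod_iff.mpr ⟨isPlot_const, hp⟩)

theorem IsPrincipalBundle.smooth_orbit (hπ : IsPrincipalBundle G π) (y : E) :
    DSmooth (fun g : G => g • y) := fun _ p hp =>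
  hπ.smooth_smul _ (fun a => (p a, y)) (isPlot_prod_iff.mpr ⟨hp, isPlot_const⟩)

/-- The value at `y` of the fundamental vector field `ξ_E` of `ξ ∈ T_e G`: the image of `ξ` under
the tangent map of the orbit map `g ↦ g • y`. -/
def fundamentalVector (hπ : IsPrincipalBundle G π) (y : E) :
    TSpace (1 : G) →ₗ[ℝ] TSpace y :=
  pushforward (hπ.smooth_orbit y) (one_smul G y)

/-- If `ξ` is the velocity at time `0` of a smooth curve `g` with `g 0 = e`, then `ξ_E` at `y` is
the velocity at time `0` of the curve `t ↦ g t • y`. -/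
theorem fundamentalVector_velocity (hπ : IsPrincipalBundle G π) (y : E) {g : ℝ → G}
    (hg : DSmooth g) (h0 : g 0 = 1) :
    fundamentalVector hπ y (velocity hg 0 h0) =
      velocity (c := fun t => g t • y) ((hπ.smooth_orbit y).comp hg) 0 (by simp [h0]) :=
  pushforward_velocity _ _ _ _ _

variable [DiffeologicalGroup G]

theorem smooth_mul_left (g : G) : DSmooth (fun h : G => g * h) := fun _ p hp =>
  DiffeologicalGroup.smooth_mul _ (fun y => (g, p y)) (isPlot_prod_iff.mpr ⟨isPlot_const, hp⟩)

theorem smooth_mul_right (g : G) : DSmooth (fun h : G => h * g) := fun _ p hp =>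
  DiffeologicalGroup.smooth_mul _ (fun y => (p y, g)) (isPlot_prod_iff.mpr ⟨hp, isPlot_const⟩)

theorem smooth_conj (g : G) : DSmooth (fun h : G => g * h * g⁻¹) :=
  (smooth_mul_right g⁻¹).comp (smooth_mul_left g)

/-- The adjoint action of `g` on `T_e G`. -/
def Ad (g : G) : TSpace (1 : G) →ₗ[ℝ] TSpace (1 : G) :=
  pushforward (smooth_conj g) (by group)

/-- The Maurer–Cartan form, `v ∈ T_g G ↦ (L_{g⁻¹})_* v ∈ T_e G`. -/
def maurerCartan (g : G) : TSpace g →ₗ[ℝ] TSpace (1 : G) :=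
  pushforward (smooth_mul_left g⁻¹) (inv_mul_cancel g)

/-- A connection 1-form on a principal `G`-bundle: a smooth fibrewise linear map `ω : TE → T_e G`
which is equivariant for the adjoint action and satisfies `ω (ξ_E) = ξ` for all `ξ ∈ T_e G`. -/
structure IsConnectionForm (hπ : IsPrincipalBundle G π)
    (ω : ∀ y : E, TSpace y →ₗ[ℝ] TSpace (1 : G)) : Prop where
  smooth : DSmooth (fun z : TBundle E => ω z.1 z.2)
  equivariant : ∀ (g : G) (y : E) (v : TSpace y),
    ω (g • y) (pushforward (hπ.smooth_act g) rfl v) = Ad g (ω y v)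
  fundamental : ∀ (y : E) (ξ : TSpace (1 : G)), ω y (fundamentalVector hπ y ξ) = ξ

end Groups

/-! ### The Milnor construction -/

section Milnor

/-- The space of pairs of sequences `(tᵢ)` in `[0,1]` and `(xᵢ)` in `∏ Xᵢ` such that only finitely
many `tᵢ` are nonzero and `∑ tᵢ = 1`, with the subset diffeology of the product diffeology. -/
abbrev PreJoin (X : ℕ → Type u) : Type u :=
  {s : (ℕ → {t : ℝ // t ∈ Icc (0 : ℝ) 1}) × (∀ i, X i) //
    {i | (s.1 i : ℝ) ≠ 0}.Finite ∧ ∑ᶠ i, (s.1 i : ℝ) = 1}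

/-- The `i`-th weight of a point. -/
def PreJoin.t {X : ℕ → Type u} (i : ℕ) (s : PreJoin X) : ℝ := s.1.1 i

/-- The `i`-th coordinate of a point. -/
def PreJoin.pr {X : ℕ → Type u} (i : ℕ) (s : PreJoin X) : X i := s.1.2 i

/-- Two points are identified in the join if their weights agree and their coordinates agree
wherever the weight is nonzero. -/
def joinSetoid (X : ℕ → Type u) : Setoid (PreJoin X) where
  r s s' := (∀ i, s.t i = s'.t i) ∧ ∀ i, s.t i ≠ 0 → s.pr i = s'.pr i
  iseqv :=
    { refl := fun _ => ⟨fun _ => rfl, fun _ _ => rfl⟩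
      symm := fun h => ⟨fun i => (h.1 i).symm, fun i hi => (h.2 i ((h.1 i).trans_ne hi)).symm⟩
      trans := fun h h' => ⟨fun i => (h.1 i).trans (h'.1 i), fun i hi =>
        (h.2 i hi).trans (h'.2 i ((h.1 i).symm.trans_ne hi))⟩ }

/-- The join of a sequence of diffeological spaces, with the quotient diffeology. -/
def Join (X : ℕ → Type u) : Type u := Quotient (joinSetoid X)

/-- The quotient map onto the join. -/
def Join.mk {X : ℕ → Type u} (s : PreJoin X) : Join X := Quotient.mk (joinSetoid X) s

instance (X : ℕ → Type u) [∀ i, DiffeologicalSpace (X i)] : DiffeologicalSpace (Join X) :=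
  quotientDiffeology inferInstance Join.mk Quotient.mk_surjective

theorem Join.smooth_mk {X : ℕ → Type u} [∀ i, DiffeologicalSpace (X i)] :
    DSmooth (Join.mk : PreJoin X → Join X) := fun _ p hp _ =>
  ⟨univ, isOpen_univ, mem_univ _, p, hp, fun _ _ => rfl⟩

theorem PreJoin.smooth_pr {X : ℕ → Type u} [∀ i, DiffeologicalSpace (X i)] (i : ℕ) :
    DSmooth (PreJoin.pr i : PreJoin X → X i) := fun _ _ hp =>
  isPlot_pi_iff.mp (isPlot_prod_iff.mp (isPlot_subtype_iff.mp hp)).2 i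

variable (G : Type u) [Group G] [DiffeologicalSpace G]

/-- The space `S_G` of pairs `(tᵢ, gᵢ)`. -/
abbrev SG : Type u := PreJoin (fun _ => G)

/-- The total space `EG`: the join of countably many copies of `G`. -/
abbrev EG : Type u := Join (fun _ => G)

/-- The action `h • (tᵢ gᵢ) = (tᵢ gᵢ h⁻¹)` of `G` on `EG`. -/
instance : MulAction G (EG G) where
  smul h := Quotient.map' (s₁ := joinSetoid _) (s₂ := joinSetoid _)
    (fun s => ⟨(s.1.1, fun i => s.1.2 i * h⁻¹), s.2⟩)
    fun _ _ hs => ⟨hs.1, fun i hi => congrArg (· * h⁻¹) (hs.2 i hi)⟩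
  one_smul y := by
    induction y using Quotient.inductionOn with
    | h s => exact Quotient.sound ⟨fun _ => rfl, fun i _ => by simp [PreJoin.pr]⟩
  mul_smul h k y := by
    induction y using Quotient.inductionOn with
    | h s => exact Quotient.sound ⟨fun _ => rfl, fun i _ => by simp [PreJoin.pr, mul_assoc]⟩

/-- The Milnor classifying space `BG = EG / G`. -/
def BG : Type u := Quotient (MulAction.orbitRel G (EG G))

/-- The projection `EG → BG`. -/
def milnorProj (y : EG G) : BG G := Quotient.mk (MulAction.orbitRel G (EG G)) y

instance : DiffeologicalSpace (BG G) :=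
  quotientDiffeology inferInstance (milnorProj G) Quotient.mk_surjective

end Milnor

end MilnorDiffeology

end

open MilnorDiffeology

noncomputable section

namespace MilnorDiffeology

open scoped ContDiff Topology

universe u v

/-! ### Locality of plots -/

section Locality

variable {X : Type u} [DiffeologicalSpace X]

/-! The form `-∑ φᵢ prᵢ^*α` on `S_G` descends to `EG` because its `i`-th term matters only where `φᵢ
≠ 0`. There `tᵢ ≠ 0`, hence `tᵢ ≠ 0` nearby along any plot, and so `gᵢ` is determined by the point
of `EG` (`weightedForm_fderiv`). Plots of `EG` lift locally to `S_G` and internal tangent spaces are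
colimits over plots, so this defines `ω` plot by plot. The same coordinate `gᵢ` trivialises the
bundle.

Equivariance and the value on fundamental fields reduce to logarithmic derivatives: `g h⁻¹` gives
`Ad h` of that of `g` (`logDeriv_mul_right`), while inversion at `e` gives a minus sign
(`logDeriv_inv`), which cancels the sign of the form since `∑ φᵢ = 1`.

For smoothness the weights `tᵢ` are unsuitable as `φᵢ`: infinitely many may be nonzero near a point.
Instead `φᵢ` is a difference of a smooth step function at consecutive partial sums of the weights,
and vanishes once the sum reaches `1/2`; this makes the sum locally finite along plots. The
minimality of the diffeology of `TX` then reduces smoothness to the maps `Tp`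
(`smooth_of_plotTangent`). -/

theorem isPlot_of_eventuallyEq {n : ℕ} {p : Euc n → X}
    (h : ∀ a, ∃ q : Euc n → X, IsPlot q ∧ ∀ᶠ y in 𝓝 a, q y = p y) : IsPlot p := by
  refine DiffeologicalSpace.locality fun a => ?_
  obtain ⟨q, hq, hqp⟩ := h a
  obtain ⟨U, hU, hUo, ha⟩ := eventually_nhds_iff.mp hqp
  refine ⟨U, hUo, ha, fun {m f} hf hfs => ?_⟩
  have hpq : p ∘ f = q ∘ f := funext fun x => (hU _ (hf x)).symm
  rw [hpq]
  exact isPlot_reparam hq hfs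

theorem isPlot_quotient_iff {Y : Type v} {f : X → Y} (hf : Function.Surjective f) {n : ℕ}
    {p : Euc n → Y} :
    (@IsPlot Y (quotientDiffeology inferInstance f hf) n p) ↔
      ∀ a, ∃ q : Euc n → X, IsPlot q ∧ ∀ᶠ y in 𝓝 a, f (q y) = p y := by
  refine forall_congr' fun a => ⟨?_, ?_⟩
  · rintro ⟨U, hU, ha, q, hq, h⟩
    exact ⟨q, hq, Filter.eventually_of_mem (hU.mem_nhds ha) h⟩
  · rintro ⟨q, hq, h⟩
    obtain ⟨U, hU, hUo, ha⟩ := eventually_nhds_iff.mp h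
    exact ⟨U, hUo, ha, q, hq, hU⟩

end Locality

/-! ### Tangent vectors -/

section TangentVectors

variable {X : Type u} [DiffeologicalSpace X] {Y : Type v} [DiffeologicalSpace Y]

/-- The map `T₀ℝⁿ → T_x X` induced by a plot `P` with `P 0 = x`. -/
def pushAt {n : ℕ} (P : Euc n → X) (hP : IsPlot P) {x : X} (hx : P 0 = x) :
    Euc n →ₗ[ℝ] TSpace x :=
  PointedPlot.push ⟨n, P, hP, hx⟩

/-- The chain rule for germs of plots. -/
theorem pushAt_fderiv {n m : ℕ} {P : Euc n → X} {Q : Euc m → X} (hP : IsPlot P) (hQ : IsPlot Q)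
    {x : X} (hP0 : P 0 = x) (hQ0 : Q 0 = x) {f : Euc n → Euc m} (hf : ContDiff ℝ ∞ f)
    (hf0 : f 0 = 0) (h : ∀ᶠ y in 𝓝 0, Q (f y) = P y) (v : Euc n) :
    pushAt Q hQ hQ0 (fderiv ℝ f 0 v) = pushAt P hP hP0 v := by
  obtain ⟨U, hU, hUo, h0⟩ := eventually_nhds_iff.mp h
  obtain ⟨χ, hχ, hχU, W, hW, h0W, hχW⟩ := exists_localizing hUo h0
  have hχ0 : χ 0 = 0 := hχW 0 h0W
  have hχid : χ =ᶠ[𝓝 0] id := Filter.eventually_of_mem (hW.mem_nhds h0W) hχW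
  -- The colimit relations need an identity of plots on all of `ℝⁿ`, but `Q ∘ f = P` holds only on
  -- `U`. The plot `P ∘ χ` maps globally to `P` by `χ` and to `Q` by `f ∘ χ`, and `χ` has derivative
  -- the identity at `0`.
  have e1 := PointedPlot.push_fderiv ⟨n, P ∘ χ, isPlot_reparam hP hχ, by simp [hχ0, hP0]⟩
    ⟨n, P, hP, hP0⟩ χ hχ hχ0 rfl v
  have e2 := PointedPlot.push_fderiv ⟨n, P ∘ χ, isPlot_reparam hP hχ, by simp [hχ0, hP0]⟩
    ⟨m, Q, hQ, hQ0⟩ (f ∘ χ) (hf.comp hχ) (by simp [hχ0, hf0])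
    (funext fun y => hU _ (hχU y)) v
  have d1 : fderiv ℝ χ 0 = ContinuousLinearMap.id ℝ _ := by rw [hχid.fderiv_eq, fderiv_id]
  have d2 : fderiv ℝ (f ∘ χ) 0 = fderiv ℝ f 0 := (hχid.fun_comp f).fderiv_eq
  rw [d1] at e1
  rw [d2] at e2
  exact e2.trans e1.symm

theorem pushAt_congr {n : ℕ} {P Q : Euc n → X} (hP : IsPlot P) (hQ : IsPlot Q)
    {x : X} (hP0 : P 0 = x) (hQ0 : Q 0 = x) (h : ∀ᶠ y in 𝓝 0, Q y = P y) :
    pushAt Q hQ hQ0 = pushAt P hP hP0 := by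
  ext1 v
  simpa using pushAt_fderiv hP hQ hP0 hQ0 contDiff_id rfl h v

theorem pushAt_linear {n m : ℕ} {P : Euc n → X} {Q : Euc m → X} (hP : IsPlot P) (hQ : IsPlot Q)
    {x : X} (hP0 : P 0 = x) (hQ0 : Q 0 = x) (L : Euc n →L[ℝ] Euc m)
    (h : ∀ y, Q (L y) = P y) (v : Euc n) :
    pushAt Q hQ hQ0 (L v) = pushAt P hP hP0 v := by
  simpa using pushAt_fderiv hP hQ hP0 hQ0 L.contDiff (map_zero L) (.of_forall h) v

/-- The zero map is an arrow from a constant plot to itself, and its derivative kills every vector.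
-/
theorem pushAt_const {n : ℕ} {P : Euc n → X} (hP : IsPlot P) {x : X} (h : ∀ y, P y = x) :
    pushAt P hP (h 0) = 0 := by
  ext1 v
  have := pushAt_linear hP hP (h 0) (h 0) 0 (fun y => (h _).trans (h y).symm) v
  simpa using this.symm

theorem pushforward_pushAt {f : X → Y} (hf : DSmooth f) {x : X} {y : Y} (hy : f x = y) {n : ℕ}
    {P : Euc n → X} (hP : IsPlot P) (hx : P 0 = x) (v : Euc n) :
    pushforward hf hy (pushAt P hP hx v) =
      pushAt (fun z => f (P z)) (hf _ _ hP) (by rw [hx, hy]) v :=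
  pushforward_push _ _ _ _

variable {x : X} {V : Type*} [AddCommGroup V] [Module ℝ V]

open Classical in
theorem TSpace.hom_ext {f g : TSpace x →ₗ[ℝ] V}
    (h : ∀ {n : ℕ} (P : Euc n → X) (hP : IsPlot P) (hx : P 0 = x) (v : Euc n),
      f (pushAt P hP hx v) = g (pushAt P hP hx v)) : f = g := by
  refine Submodule.linearMap_qext _ (DirectSum.linearMap_ext _ fun p => ?_)
  ext1 v
  exact h p.toFun p.isPlot p.map_zero v

open Classical in
/-- The universal property of the colimit `T_x X`. -/
def TSpace.lift (F : ∀ p : PointedPlot x, Euc p.dim →ₗ[ℝ] V)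
    (hF : ∀ (p q : PointedPlot x) (f : Euc p.dim → Euc q.dim), ContDiff ℝ ∞ f → f 0 = 0 →
      q.toFun ∘ f = p.toFun → ∀ v, F q (fderiv ℝ f 0 v) = F p v) : TSpace x →ₗ[ℝ] V :=
  (tangentRelations x).liftQ (DirectSum.toModule ℝ (PointedPlot x) V F) <| by
    refine Submodule.span_le.mpr ?_
    rintro _ ⟨p, q, f, v, hf, hf0, hfq, rfl⟩
    rw [SetLike.mem_coe, LinearMap.mem_ker, map_sub, DirectSum.toModule_lof,
      DirectSum.toModule_lof, sub_eq_zero]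
    exact (hF p q f hf hf0 hfq v).symm

open Classical in
theorem TSpace.lift_push (F : ∀ p : PointedPlot x, Euc p.dim →ₗ[ℝ] V)
    (hF : ∀ (p q : PointedPlot x) (f : Euc p.dim → Euc q.dim), ContDiff ℝ ∞ f → f 0 = 0 →
      q.toFun ∘ f = p.toFun → ∀ v, F q (fderiv ℝ f 0 v) = F p v) (p : PointedPlot x)
    (v : Euc p.dim) : TSpace.lift F hF (p.push v) = F p v :=
  (Submodule.liftQ_apply _ _ _).trans (DirectSum.toModule_lof _ _ _)

end TangentVectors

/-! ### The diffeology of the tangent bundle -/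

section TangentBundle

variable {X : Type u} [DiffeologicalSpace X]

theorem isPlot_tBundle_iff {n : ℕ} {p : Euc n → TBundle X} :
    IsPlot p ↔ ∀ d : DiffeologicalSpace (TBundle X), IsVectorPseudoBundle d →
      (∀ {n : ℕ} {p : Euc n → X} (hp : IsPlot p),
        @DSmooth (Euc n × Euc n) (TBundle X) _ d (plotTangent hp)) → @IsPlot _ d n p := by
  refine DiffeologicalSpace.isPlot_sInf_iff.trans ?_
  exact ⟨fun h d h1 h2 => h d ⟨h1, h2⟩, fun h d hd => h d hd.1 hd.2⟩

theorem isPlot_tSpace_iff {x : X} {n : ℕ} {p : Euc n → TSpace x} :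
    IsPlot p ↔ @IsPlot (TBundle X) _ n (fun a => ⟨x, p a⟩) := Iff.rfl

theorem smooth_plotTangent {n : ℕ} {p : Euc n → X} (hp : IsPlot p) : DSmooth (plotTangent hp) :=
  fun m q hq => isPlot_tBundle_iff.mpr fun _ _ h => h hp m q hq

theorem isPlot_tSpace_add {x : X} {n : ℕ} {v w : Euc n → TSpace x} (hv : IsPlot v)
    (hw : IsPlot w) : IsPlot (fun a => v a + w a) :=
  isPlot_tSpace_iff.mpr <| isPlot_tBundle_iff.mpr fun d h1 h2 =>
    h1.smooth_add (fun _ => x) v w (isPlot_tBundle_iff.mp hv d h1 h2)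
      (isPlot_tBundle_iff.mp hw d h1 h2)

theorem isPlot_tSpace_smul {x : X} {n : ℕ} {r : Euc n → ℝ} {v : Euc n → TSpace x}
    (hr : IsPlot r) (hv : IsPlot v) : IsPlot (fun a => r a • v a) :=
  isPlot_tSpace_iff.mpr <| isPlot_tBundle_iff.mpr fun d h1 h2 =>
    h1.smooth_smul r (fun _ => x) v hr (isPlot_tBundle_iff.mp hv d h1 h2)

theorem isPlot_tSpace_neg {x : X} {n : ℕ} {v : Euc n → TSpace x} (hv : IsPlot v) :
    IsPlot (fun a => -v a) := by
  simpa using isPlot_tSpace_smul (isPlot_const (x := (-1 : ℝ))) hv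

theorem isPlot_tSpace_sum {ι : Type*} {x : X} {n : ℕ} (s : Finset ι) {v : ι → Euc n → TSpace x}
    (hv : ∀ i ∈ s, IsPlot (v i)) : IsPlot (fun a => ∑ i ∈ s, v i a) := by
  classical
  induction s using Finset.induction_on with
  | empty => simpa using isPlot_const
  | insert i s hi ih =>
    simp only [Finset.sum_insert hi]
    exact isPlot_tSpace_add (hv i (Finset.mem_insert_self i s))
      (ih fun j hj => hv j (Finset.mem_insert_of_mem hj))

/-- A fibrewise linear map from `TX` to a fixed tangent space is smooth as soon as its compositions
with all maps `Tp`, `p` a plot, are smooth. -/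
theorem smooth_of_plotTangent {Y : Type v} [DiffeologicalSpace Y] {y : Y}
    (θ : ∀ x : X, TSpace x →ₗ[ℝ] TSpace y)
    (h : ∀ {n : ℕ} {p : Euc n → X} (hp : IsPlot p) {m : ℕ} (a v : Euc m → Euc n),
      IsPlot a → IsPlot v →
        IsPlot fun u => θ (p (a u)) ((PointedPlot.translate hp (a u)).push (v u))) :
    DSmooth (fun z : TBundle X => θ z.1 z.2) := by
  intro n p hp
  -- The coarsest diffeology making the projection and `θ` smooth. Linearity of `θ` on fibres makes
  -- it a vector pseudo-bundle and `h` makes every `Tp` smooth, so by minimality each plot of `TX`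
  -- is a plot of `d`.
  let d : DiffeologicalSpace (TBundle X) :=
    inducedDiffeology (fun z : TBundle X => z.1) inferInstance ⊓
      inducedDiffeology (fun z : TBundle X => θ z.1 z.2) inferInstance
  have hd : ∀ {n : ℕ} {p : Euc n → TBundle X}, (@IsPlot _ d n p) ↔
      IsPlot (fun a => (p a).1) ∧ IsPlot (fun a => θ (p a).1 (p a).2) :=
    DiffeologicalSpace.isPlot_inf_iff
  refine (hd.mp (isPlot_tBundle_iff.mp hp d ⟨?_, ?_, ?_, ?_⟩ ?_)).2
  · exact fun n p hp => (hd.mp hp).1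
  · intro n x v w hv hw
    refine hd.mpr ⟨(hd.mp hv).1, ?_⟩
    simp only [map_add]
    exact isPlot_tSpace_add (hd.mp hv).2 (hd.mp hw).2
  · intro n r x v hr hv
    refine hd.mpr ⟨(hd.mp hv).1, ?_⟩
    simp only [map_smul]
    exact isPlot_tSpace_smul hr (hd.mp hv).2
  · intro n p hp
    refine hd.mpr ⟨hp, ?_⟩
    change IsPlot fun a => θ (p a) 0
    simp only [map_zero]
    exact isPlot_const
  · intro n p hp m q hq
    obtain ⟨h1, h2⟩ := isPlot_prod_iff.mp hq
    exact hd.mpr ⟨isPlot_reparam hp h1.contDiff, h hp _ _ h1 h2⟩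

/-- An equality in the total space, so that base points which agree only propositionally can be
compared. -/
theorem TBundle.mk_pushAt_eq {n m : ℕ} {P : Euc n → X} {Q : Euc m → X} (hP : IsPlot P)
    (hQ : IsPlot Q) {x x' : X} (hx : P 0 = x) (hx' : Q 0 = x') (L : Euc n →L[ℝ] Euc m)
    (h : ∀ y, Q (L y) = P y) (v : Euc n) :
    (⟨x', pushAt Q hQ hx' (L v)⟩ : TBundle X) = ⟨x, pushAt P hP hx v⟩ := by
  obtain rfl : x = x' := by rw [← hx, ← hx', ← h 0, map_zero]
  rw [pushAt_linear hP hQ hx hx' L h]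

end TangentBundle

/-! ### Logarithmic derivatives -/

section LogDeriv

variable {G : Type u} [Group G] [DiffeologicalSpace G] [DiffeologicalGroup G]

theorem IsPlot.mul {n : ℕ} {g h : Euc n → G} (hg : IsPlot g) (hh : IsPlot h) :
    IsPlot (fun y => g y * h y) :=
  DiffeologicalGroup.smooth_mul _ (fun y => (g y, h y)) (isPlot_prod_iff.mpr ⟨hg, hh⟩)

theorem IsPlot.inv {n : ℕ} {g : Euc n → G} (hg : IsPlot g) : IsPlot (fun y => (g y)⁻¹) :=
  DiffeologicalGroup.smooth_inv _ g hg

/-- The pullback `g^*α` of the Maurer–Cartan form along a plot `g`, at the origin. -/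
def logDeriv {n : ℕ} (g : Euc n → G) (hg : IsPlot g) : Euc n →ₗ[ℝ] TSpace (1 : G) :=
  pushAt (fun y => (g 0)⁻¹ * g y) (IsPlot.mul isPlot_const hg) (inv_mul_cancel _)

theorem maurerCartan_pushAt {n : ℕ} {g : Euc n → G} (hg : IsPlot g) {x : G} (hx : g 0 = x)
    (v : Euc n) : maurerCartan x (pushAt g hg hx v) = logDeriv g hg v := by
  subst hx
  exact pushforward_pushAt _ _ _ _ _

theorem logDeriv_fderiv {n m : ℕ} {g : Euc n → G} {h : Euc m → G} (hg : IsPlot g)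
    (hh : IsPlot h) {f : Euc n → Euc m} (hf : ContDiff ℝ ∞ f) (hf0 : f 0 = 0)
    (e : ∀ᶠ y in 𝓝 0, h (f y) = g y) (v : Euc n) :
    logDeriv h hh (fderiv ℝ f 0 v) = logDeriv g hg v := by
  refine pushAt_fderiv _ _ _ _ hf hf0 (e.mono fun y hy => ?_) v
  have h0 := e.self_of_nhds
  rw [hf0] at h0
  rw [hy, h0]

/-- With `g₀ = g 0`, one has `(g₀ h⁻¹)⁻¹ (g h⁻¹) = h (g₀⁻¹ g) h⁻¹`. -/
theorem logDeriv_mul_right {n : ℕ} {g : Euc n → G} (hg : IsPlot g) (h : G) (v : Euc n) :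
    logDeriv (fun y => g y * h⁻¹) (IsPlot.mul hg isPlot_const) v = Ad h (logDeriv g hg v) := by
  refine Eq.trans ?_ (pushforward_pushAt (smooth_conj h) _ _ _ _).symm
  refine congrFun (congrArg _ (pushAt_congr _ _ _ _ (.of_forall fun y => ?_))) v
  group

theorem logDeriv_mul_left {n : ℕ} {g : Euc n → G} (hg : IsPlot g) (h : G) (v : Euc n) :
    logDeriv (fun y => h * g y) (IsPlot.mul isPlot_const hg) v = logDeriv g hg v := by
  refine congrFun (congrArg _ (pushAt_congr _ _ _ _ (.of_forall fun y => ?_))) v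
  group

/-- The plot `(y, z) ↦ g y * (g z)⁻¹` is constant on the diagonal, so by linearity its two partial
derivatives at the origin in direction `v` add up to zero. -/
theorem logDeriv_inv {n : ℕ} {g : Euc n → G} (hg : IsPlot g) (h0 : g 0 = 1) (v : Euc n) :
    logDeriv (fun y => (g y)⁻¹) (IsPlot.inv hg) v = -pushAt g hg h0 v := by
  let e := EuclideanSpace.finAddEquivProd (𝕜 := ℝ) (n := n) (m := n)
  let P : Euc (n + n) → G := fun z => g (e z).1 * (g (e z).2)⁻¹
  have hP : IsPlot P := IsPlot.mul (isPlot_reparam hg (contDiff_fst.comp e.contDiff))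
    (IsPlot.inv (isPlot_reparam hg (contDiff_snd.comp e.contDiff)))
  have hP0 : P 0 = 1 := by simp [P]
  let L₁ : Euc n →L[ℝ] Euc (n + n) :=
    (e.symm : _ →L[ℝ] _).comp (ContinuousLinearMap.inl ℝ (Euc n) (Euc n))
  let L₂ : Euc n →L[ℝ] Euc (n + n) :=
    (e.symm : _ →L[ℝ] _).comp (ContinuousLinearMap.inr ℝ (Euc n) (Euc n))
  have e₁ : pushAt P hP hP0 (L₁ v) = pushAt g hg h0 v :=
    pushAt_linear _ _ _ _ _ (fun y => by simp [P, L₁, h0]) v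
  have e₂ : pushAt P hP hP0 (L₂ v) = logDeriv (fun y => (g y)⁻¹) (IsPlot.inv hg) v :=
    pushAt_linear _ _ _ _ _ (fun y => by simp [P, L₂, h0]) v
  have e₃ : pushAt P hP hP0 ((L₁ + L₂) v) = pushAt (fun _ : Euc n => (1 : G)) isPlot_const rfl v :=
    pushAt_linear _ _ _ _ _ (fun y => by simp [P, L₁, L₂]) v
  rw [pushAt_const _ (fun _ => rfl), add_apply, map_add, e₁, e₂] at e₃
  exact eq_neg_of_add_eq_zero_right e₃

/-- The Maurer–Cartan form is smooth along plots. -/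
theorem isPlot_logDeriv {n m : ℕ} {g : Euc n → G} (hg : IsPlot g) {a v : Euc m → Euc n}
    (ha : IsPlot a) (hv : IsPlot v) :
    IsPlot fun u => logDeriv (fun y => g (a u + y))
      (isPlot_reparam hg (contDiff_const.add contDiff_id)) (v u) := by
  let e := EuclideanSpace.finAddEquivProd (𝕜 := ℝ) (n := n) (m := n)
  -- The logarithmic derivative of `g` at `a` along `v` is `TP` at the point `(a, a)` in the
  -- direction `(0, v)`, and `TP` is smooth by definition of the diffeology of `TG`.
  let P : Euc (n + n) → G := fun z => (g (e z).1)⁻¹ * g (e z).2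
  have hP : IsPlot P := IsPlot.mul
    (IsPlot.inv (isPlot_reparam hg (contDiff_fst.comp e.contDiff)))
    (isPlot_reparam hg (contDiff_snd.comp e.contDiff))
  let L : Euc n →L[ℝ] Euc (n + n) :=
    (e.symm : _ →L[ℝ] _).comp (ContinuousLinearMap.inr ℝ (Euc n) (Euc n))
  have ha' : ContDiff ℝ ∞ fun u => e.symm (a u, a u) :=
    e.symm.contDiff.comp (ha.contDiff.prodMk ha.contDiff)
  have hT := smooth_plotTangent hP _ (fun u => (e.symm (a u, a u), L (v u)))
    (isPlot_prod_iff.mpr ⟨ha'.isPlot, (L.contDiff.comp hv.contDiff).isPlot⟩)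
  refine isPlot_tSpace_iff.mpr ?_
  refine Eq.mp (congrArg (@IsPlot (TBundle G) _ m) (funext fun u => ?_)) hT
  refine (TBundle.mk_pushAt_eq _ (PointedPlot.translate hP (e.symm (a u, a u))).isPlot _
    (PointedPlot.translate hP (e.symm (a u, a u))).map_zero L (fun y => ?_) (v u))
  simp [P, L]

end LogDeriv

/-! ### Coordinates on the Milnor spaces -/

section Coordinates

variable {X : ℕ → Type u}

theorem isPlot_preJoin_iff [∀ i, DiffeologicalSpace (X i)] {n : ℕ} {r : Euc n → PreJoin X} :
    IsPlot r ↔ (∀ i, IsPlot fun y => (r y).t i) ∧ ∀ i, IsPlot fun y => (r y).pr i :=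
  isPlot_subtype_iff.trans <| isPlot_prod_iff.trans <| and_congr isPlot_pi_iff isPlot_pi_iff

/-- The `i`-th weight of a point of the join. -/
def Join.t (i : ℕ) : Join X → ℝ := Quotient.lift (PreJoin.t i) fun _ _ h => h.1 i

/-- The `i`-th coordinate of a point of the join; meaningful where the `i`-th weight is nonzero. -/
def Join.coord (i : ℕ) (y : Join X) : X i := (Quotient.out y).pr i

theorem Join.t_mk (i : ℕ) (s : PreJoin X) : Join.t i (Join.mk s) = s.t i := rfl

theorem Join.pr_eq_of_mk_eq {s s' : PreJoin X} (h : Join.mk s = Join.mk s') {i : ℕ}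
    (hi : s.t i ≠ 0) : s.pr i = s'.pr i :=
  (Quotient.exact h).2 i hi

theorem Join.coord_mk {i : ℕ} {s : PreJoin X} (hi : s.t i ≠ 0) :
    Join.coord i (Join.mk s) = s.pr i :=
  (Join.pr_eq_of_mk_eq (Quotient.out_eq (Join.mk s)).symm hi).symm

theorem Join.exists_lift [∀ i, DiffeologicalSpace (X i)] {n : ℕ} {p : Euc n → Join X}
    (hp : IsPlot p) (a : Euc n) :
    ∃ q : Euc n → PreJoin X, IsPlot q ∧ ∀ᶠ y in 𝓝 a, Join.mk (q y) = p y :=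
  (isPlot_quotient_iff Quotient.mk_surjective).mp hp a

theorem PreJoin.isPlot_pr [∀ i, DiffeologicalSpace (X i)] {n : ℕ} {q : Euc n → PreJoin X}
    (hq : IsPlot q) (i : ℕ) : IsPlot fun y => (q y).pr i :=
  PreJoin.smooth_pr i _ q hq

end Coordinates

/-! ### The action on `EG`, the projection to `BG`, and local triviality -/

section Milnor

variable {G : Type u} [Group G]

/-- The action of `h` on `S_G`, `(tᵢ, gᵢ) ↦ (tᵢ, gᵢ h⁻¹)`. -/
def SG.act (h : G) (s : SG G) : SG G := ⟨(s.1.1, fun i => s.1.2 i * h⁻¹), s.2⟩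

theorem smul_mk (h : G) (s : SG G) : h • (Join.mk s : EG G) = Join.mk (SG.act h s) := rfl

theorem t_smul (h : G) (y : EG G) (i : ℕ) : Join.t i (h • y) = Join.t i y := by
  induction y using Quotient.inductionOn with
  | h s => rfl

theorem milnorProj_eq_iff {y z : EG G} :
    milnorProj G y = milnorProj G z ↔ ∃ h : G, h • z = y :=
  Quotient.eq.trans MulAction.orbitRel_apply

theorem milnorProj_smul (h : G) (y : EG G) : milnorProj G (h • y) = milnorProj G y :=
  milnorProj_eq_iff.mpr ⟨h, rfl⟩

/-- The `i`-th weight of a point of `BG`. -/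
def BG.t (i : ℕ) : BG G → ℝ := Quotient.lift (Join.t i) fun y z h => by
  obtain ⟨g, rfl⟩ := MulAction.orbitRel_apply.mp h
  exact t_smul g z i

theorem BG.t_proj (i : ℕ) (y : EG G) : BG.t i (milnorProj G y) = Join.t i y := rfl

theorem BG.exists_rep (b : BG G) : ∃ s : SG G, milnorProj G (Join.mk s) = b := by
  obtain ⟨y, rfl⟩ := Quotient.mk_surjective b
  obtain ⟨s, rfl⟩ := Quotient.mk_surjective y
  exact ⟨s, rfl⟩

theorem PreJoin.exists_t_ne_zero {X : ℕ → Type u} (s : PreJoin X) : ∃ i, s.t i ≠ 0 := by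
  by_contra! h
  have h1 := s.2.2
  exact zero_ne_one ((finsum_eq_zero_of_forall_eq_zero h).symm.trans h1)

section Plots

variable [DiffeologicalSpace G]

theorem BG.exists_lift {n : ℕ} {p : Euc n → BG G} (hp : IsPlot p) (a : Euc n) :
    ∃ r : Euc n → SG G, IsPlot r ∧ ∀ᶠ y in 𝓝 a, milnorProj G (Join.mk (r y)) = p y := by
  obtain ⟨q, hq, hqp⟩ := (isPlot_quotient_iff Quotient.mk_surjective).mp hp a
  obtain ⟨r, hr, hrq⟩ := Join.exists_lift hq a
  refine ⟨r, hr, ?_⟩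
  filter_upwards [hqp, hrq] with y h1 h2
  rw [h2]
  exact h1

theorem smooth_milnorProj : DSmooth (milnorProj G) := fun _ p hp _ =>
  ⟨univ, isOpen_univ, mem_univ _, p, hp, fun _ _ => rfl⟩

theorem BG.smooth_t (i : ℕ) : DSmooth (BG.t i : BG G → ℝ) := fun n p hp =>
  isPlot_of_eventuallyEq fun a => by
    obtain ⟨r, hr, h⟩ := BG.exists_lift hp a
    refine ⟨fun y => (r y).t i, (isPlot_preJoin_iff.mp hr).1 i, h.mono fun y hy => ?_⟩
    rw [Function.comp_apply, ← hy]
    rfl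

variable [DiffeologicalGroup G]

theorem SG.isPlot_act {n : ℕ} {g : Euc n → G} {r : Euc n → SG G} (hg : IsPlot g)
    (hr : IsPlot r) : IsPlot fun y => SG.act (g y) (r y) :=
  isPlot_preJoin_iff.mpr ⟨(isPlot_preJoin_iff.mp hr).1,
    fun i => IsPlot.mul ((isPlot_preJoin_iff.mp hr).2 i) (IsPlot.inv hg)⟩

theorem EG.isPlot_smul {n : ℕ} {g : Euc n → G} {p : Euc n → EG G} (hg : IsPlot g)
    (hp : IsPlot p) : IsPlot fun y => g y • p y :=
  isPlot_of_eventuallyEq fun a => by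
    obtain ⟨r, hr, h⟩ := Join.exists_lift hp a
    refine ⟨_, Join.smooth_mk _ _ (SG.isPlot_act hg hr), h.mono fun y hy => ?_⟩
    rw [← hy]
    rfl

/-- The Milnor bundle is a principal bundle. -/
theorem isPrincipalBundle_milnorProj : IsPrincipalBundle G (milnorProj G) where
  smooth_proj := smooth_milnorProj
  surjective_proj := Quotient.mk_surjective
  smooth_smul n p hp := by
    obtain ⟨h1, h2⟩ := isPlot_prod_iff.mp hp
    exact EG.isPlot_smul h1 h2
  locally_trivial {n} p hp a := by
    obtain ⟨r, hr, hrp⟩ := BG.exists_lift hp a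
    -- Where the `i`-th weight is nonzero, which is an open condition along `r`, the `i`-th
    -- coordinate is well defined on `EG` and recovers the group element.
    obtain ⟨i, hi⟩ := (r a).exists_t_ne_zero
    have hri : ∀ᶠ y in 𝓝 a, (r y).t i ≠ 0 :=
      (((isPlot_preJoin_iff.mp hr).1 i).contDiff.continuous.continuousAt).eventually_ne hi
    obtain ⟨V, hV, hVo, haV⟩ := eventually_nhds_iff.mp (hrp.and hri)
    have hri' : ∀ {x} (_ : x ∈ V) (g : G), Join.coord i (g • (Join.mk (r x) : EG G)) =
        (r x).pr i * g⁻¹ := fun hx g => Join.coord_mk (s := SG.act g (r _)) (hV _ hx).2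
    refine ⟨V, hVo, haV, fun x => Join.mk (r x), fun m q hq => Join.smooth_mk _ _
      (isPlot_reparam hr (isPlot_subtype_iff.mp hq).contDiff), fun x => (hV x x.2).1,
      { toFun := fun z => ⟨(z.1, z.2 • Join.mk (r z.1)), by
          rw [milnorProj_smul]
          exact (hV _ z.1.2).1.symm⟩
        -- A point `g • r x` has `i`-th coordinate `rᵢ g⁻¹`; solve for `g`.
        invFun := fun z => (z.1.1, (Join.coord i z.1.2)⁻¹ * (r z.1.1).pr i)
        left_inv := ?_
        right_inv := ?_ }, ?_, ?_, fun x g => rfl⟩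
    · rintro ⟨x, g⟩
      refine Prod.ext rfl ?_
      dsimp only
      rw [hri' x.2]
      group
    · rintro ⟨⟨x, y⟩, hz⟩
      obtain ⟨g, rfl⟩ := milnorProj_eq_iff.mp (hz.symm.trans (hV x x.2).1.symm)
      refine Subtype.ext (Prod.ext rfl ?_)
      dsimp only
      rw [hri' x.2]
      congr 1
      group
    · intro m q hq
      obtain ⟨h1, h2⟩ := isPlot_prod_iff.mp hq
      exact isPlot_subtype_iff.mpr <| isPlot_prod_iff.mpr ⟨h1, EG.isPlot_smul h2 <|
        Join.smooth_mk _ _ (isPlot_reparam hr (isPlot_subtype_iff.mp h1).contDiff)⟩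
    · intro m q hq
      obtain ⟨h1, h2⟩ := isPlot_prod_iff.mp (isPlot_subtype_iff.mp hq)
      have h1' := (isPlot_subtype_iff.mp h1).contDiff
      refine isPlot_prod_iff.mpr ⟨h1, IsPlot.mul (IsPlot.inv ?_)
        ((isPlot_preJoin_iff.mp (isPlot_reparam hr h1')).2 i)⟩
      -- `Join.coord` uses an arbitrary representative, so its smoothness is read off from a local
      -- lift `s`. The `i`-th weight of `s` is nonzero because `s` and `r` lie over the same point
      -- of `BG`.
      refine isPlot_of_eventuallyEq fun u => ?_
      obtain ⟨s, hs, hsq⟩ := Join.exists_lift h2 u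
      refine ⟨_, (isPlot_preJoin_iff.mp hs).2 i, hsq.mono fun w hw => ?_⟩
      change Join.mk (s w) = (q w).1.2 at hw
      have ht : (s w).t i ≠ 0 := by
        rw [← Join.t_mk, hw, ← BG.t_proj, ← (q w).2, ← (hV _ (q w).1.1.2).1, BG.t_proj,
          Join.t_mk]
        exact (hV _ (q w).1.1.2).2
      rw [← hw, Join.coord_mk ht]

end Plots

/-! ### A partition of unity on `BG` -/

/-- The partial sum of the first `n` weights. -/
def BG.weightSum (n : ℕ) (b : BG G) : ℝ := ∑ j ∈ Finset.range n, BG.t j b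

theorem BG.t_nonneg (i : ℕ) (b : BG G) : 0 ≤ BG.t i b := by
  obtain ⟨s, rfl⟩ := BG.exists_rep b
  exact (s.1.1 i).2.1

theorem BG.weightSum_mono (b : BG G) : Monotone fun n => BG.weightSum n b :=
  monotone_nat_of_le_succ fun n => by
    simp only [BG.weightSum, Finset.sum_range_succ]
    linarith [BG.t_nonneg n b]

theorem BG.exists_weightSum_eq_one (b : BG G) : ∃ n, BG.weightSum n b = 1 := by
  obtain ⟨s, rfl⟩ := BG.exists_rep b
  obtain ⟨N, hN⟩ := s.2.1.bddAbove
  -- `N` bounds the indices of nonzero weights and may itself be one, while `range` excludes its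
  -- endpoint.
  refine ⟨N + 1, Eq.trans ?_ s.2.2⟩
  refine (finsum_eq_sum_of_support_subset _ fun i hi => ?_).symm
  simpa [Nat.lt_succ_iff] using hN hi

/-- A partition of unity on `BG` which is locally finite along plots. -/
def BG.partition (i : ℕ) (b : BG G) : ℝ :=
  Real.smoothTransition (2 * BG.weightSum (i + 1) b) -
    Real.smoothTransition (2 * BG.weightSum i b)

theorem BG.partition_nonneg (i : ℕ) (b : BG G) : 0 ≤ BG.partition i b :=
  sub_nonneg.mpr <| Real.smoothTransition.monotone <|
    mul_le_mul_of_nonneg_left (BG.weightSum_mono b i.le_succ) zero_le_two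

theorem BG.partition_eq_zero {i : ℕ} {b : BG G} (h : BG.t i b = 0) : BG.partition i b = 0 := by
  rw [BG.partition, BG.weightSum, Finset.sum_range_succ, h, add_zero, BG.weightSum, sub_self]

/-- Past a partial sum of `1/2`, the factor `2` puts both step functions at their terminal value
`1`. -/
theorem BG.partition_eq_zero_of_le {n : ℕ} {b : BG G} (h : 1 / 2 ≤ BG.weightSum n b) {i : ℕ}
    (hi : n ≤ i) : BG.partition i b = 0 := by
  have h1 := BG.weightSum_mono b hi
  have h2 := BG.weightSum_mono b i.le_succ
  dsimp only at h1 h2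
  rw [BG.partition, Real.smoothTransition.one_of_one_le, Real.smoothTransition.one_of_one_le,
    sub_self] <;> linarith

/-- The number of weights needed to sum to one. -/
def BG.size (b : BG G) : ℕ := (BG.exists_weightSum_eq_one b).choose

theorem BG.le_weightSum_size (b : BG G) : 1 / 2 ≤ BG.weightSum (BG.size b) b := by
  rw [BG.size, (BG.exists_weightSum_eq_one b).choose_spec]
  norm_num

/-- Any `n` with partial sum at least `1/2` truncates the sum: the pointwise `BG.size` serves for
the algebra, a locally uniform bound for smoothness. -/
theorem BG.finsum_partition_smul {V : Type*} [AddCommGroup V] [Module ℝ V] {n : ℕ} {b : BG G}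
    (h : 1 / 2 ≤ BG.weightSum n b) (f : ℕ → V) :
    ∑ᶠ i, BG.partition i b • f i = ∑ i ∈ Finset.range n, BG.partition i b • f i := by
  refine finsum_eq_sum_of_support_subset _ fun i hi => ?_
  by_contra hni
  refine hi ?_
  dsimp only
  rw [BG.partition_eq_zero_of_le h (by simpa using hni), zero_smul]

theorem BG.finsum_partition (b : BG G) : ∑ᶠ i, BG.partition i b = 1 := by
  obtain ⟨n, hn⟩ := BG.exists_weightSum_eq_one b
  have h := BG.finsum_partition_smul (b := b) (n := n) (by rw [hn]; norm_num) fun _ => (1 : ℝ)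
  simp only [smul_eq_mul, mul_one] at h
  rw [h]
  simp only [BG.partition]
  -- The sum telescopes to the values of the step function at `2` and `0`.
  rw [Finset.sum_range_sub fun i => Real.smoothTransition (2 * BG.weightSum i b), hn,
    Real.smoothTransition.one_of_one_le (by norm_num),
    Real.smoothTransition.zero_of_nonpos (by simp [BG.weightSum]), sub_zero]

variable [DiffeologicalSpace G]

theorem BG.contDiff_weightSum {n : ℕ} {p : Euc n → BG G} (hp : IsPlot p) (k : ℕ) :
    ContDiff ℝ ∞ fun y => BG.weightSum k (p y) :=
  ContDiff.sum fun i _ => (BG.smooth_t i _ p hp).contDiff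

theorem BG.smooth_partition (i : ℕ) : DSmooth (BG.partition i : BG G → ℝ) := fun _ _ hp =>
  ((Real.smoothTransition.contDiff.comp (contDiff_const.mul (BG.contDiff_weightSum hp _))).sub
    (Real.smoothTransition.contDiff.comp (contDiff_const.mul (BG.contDiff_weightSum hp _)))).isPlot

/-- A partial sum equal to `1` at `a` stays above `1/2` nearby by continuity. This is the local
finiteness of the partition along plots. -/
theorem BG.exists_eventually_le_weightSum {n : ℕ} {p : Euc n → BG G} (hp : IsPlot p)
    (a : Euc n) : ∃ k, ∀ᶠ y in 𝓝 a, 1 / 2 ≤ BG.weightSum k (p y) := by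
  obtain ⟨k, hk⟩ := BG.exists_weightSum_eq_one (p a)
  refine ⟨k, ((BG.contDiff_weightSum hp k).continuous.continuousAt).eventually_const_le ?_⟩
  dsimp only
  rw [hk]
  norm_num

end Milnor

/-! ### The connection form -/

section Connection

variable {G : Type u} [Group G] [DiffeologicalSpace G] [DiffeologicalGroup G]

/-- The weighted sum `-∑ φᵢ(b) prᵢ^*α` of Maurer–Cartan forms, along a plot of `S_G`. -/
def weightedForm (b : BG G) {n : ℕ} (q : Euc n → SG G) (hq : IsPlot q) :
    Euc n →ₗ[ℝ] TSpace (1 : G) :=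
  -∑ i ∈ Finset.range (BG.size b),
    BG.partition i b • logDeriv (fun y => (q y).pr i) (PreJoin.isPlot_pr hq i)

theorem weightedForm_apply (b : BG G) {n : ℕ} {q : Euc n → SG G} (hq : IsPlot q) (v : Euc n) :
    weightedForm b q hq v =
      -∑ᶠ i, BG.partition i b • logDeriv (fun y => (q y).pr i) (PreJoin.isPlot_pr hq i) v := by
  rw [BG.finsum_partition_smul (BG.le_weightSum_size b)]
  simp [weightedForm]

/-- The descent step. A nonzero `φᵢ(b)` forces `tᵢ ≠ 0` at the origin, hence near it, and there
equality in `EG` forces equality of the `i`-th coordinates. With `f` the identity it gives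
independence of the lift, for general `f` compatibility with the colimit. -/
theorem weightedForm_fderiv {b : BG G} {n m : ℕ} {q : Euc n → SG G} {r : Euc m → SG G}
    (hq : IsPlot q) (hr : IsPlot r) {f : Euc n → Euc m} (hf : ContDiff ℝ ∞ f) (hf0 : f 0 = 0)
    (e : ∀ᶠ y in 𝓝 0, (Join.mk (q y) : EG G) = Join.mk (r (f y)))
    (hb : milnorProj G (Join.mk (q 0)) = b) (v : Euc n) :
    weightedForm b r hr (fderiv ℝ f 0 v) = weightedForm b q hq v := by
  rw [weightedForm_apply, weightedForm_apply]
  congr 2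
  funext i
  by_cases hi : BG.partition i b = 0
  · rw [hi, zero_smul, zero_smul]
  have ht : (q 0).t i ≠ 0 := fun h => hi (BG.partition_eq_zero (by rw [← hb]; exact h))
  congr 1
  refine logDeriv_fderiv _ _ hf hf0 ?_ v
  filter_upwards [e, ((isPlot_preJoin_iff.mp hq).1 i).contDiff.continuous.continuousAt.eventually_ne
    ht] with y h1 h2
  exact (Join.pr_eq_of_mk_eq h1 h2).symm

variable (G) in
/-- The connection form on `EG`. -/
def milnorConnection (y : EG G) : TSpace y →ₗ[ℝ] TSpace (1 : G) :=
  TSpace.lift (fun p => weightedForm (milnorProj G y) (Join.exists_lift p.isPlot 0).choose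
      (Join.exists_lift p.isPlot 0).choose_spec.1) fun p p' f hf hf0 hfp v => by
    obtain ⟨hq, e⟩ := (Join.exists_lift p.isPlot 0).choose_spec
    obtain ⟨hr, e'⟩ := (Join.exists_lift p'.isPlot 0).choose_spec
    refine weightedForm_fderiv hq hr hf hf0 ?_ ?_ v
    · have hc := hf.continuous.tendsto 0
      rw [hf0] at hc
      filter_upwards [e, hc.eventually e'] with z h1 h2
      rw [h1, h2, ← hfp]
      rfl
    · rw [e.self_of_nhds, p.map_zero]

theorem milnorConnection_pushAt {n : ℕ} {P : Euc n → EG G} (hP : IsPlot P) {y : EG G}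
    (hy : P 0 = y) {q : Euc n → SG G} (hq : IsPlot q)
    (e : ∀ᶠ z in 𝓝 0, Join.mk (q z) = P z) (v : Euc n) :
    milnorConnection G y (pushAt P hP hy v) = weightedForm (milnorProj G y) q hq v := by
  refine (TSpace.lift_push _ _ ⟨n, P, hP, hy⟩ v).trans ?_
  obtain ⟨hr, e'⟩ := (Join.exists_lift hP 0).choose_spec
  have := weightedForm_fderiv (b := milnorProj G y) hq hr contDiff_id rfl ?_ ?_ v
  · simpa using this
  · filter_upwards [e, e'] with z h1 h2
    exact h1.trans h2.symm
  · rw [e.self_of_nhds, hy]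

theorem milnorConnection_mk (s : SG G) (v : TSpace s) :
    milnorConnection G (Join.mk s) (pushforward Join.smooth_mk rfl v) =
      -∑ᶠ i, BG.partition i (milnorProj G (Join.mk s)) •
        maurerCartan (s.pr i) (pushforward (PreJoin.smooth_pr i) rfl v) := by
  rw [BG.finsum_partition_smul (BG.le_weightSum_size _)]
  let F : TSpace s →ₗ[ℝ] TSpace (1 : G) :=
    -∑ i ∈ Finset.range (BG.size (milnorProj G (Join.mk s))),
      BG.partition i (milnorProj G (Join.mk s)) •
        (maurerCartan (s.pr i) ∘ₗ pushforward (PreJoin.smooth_pr i) rfl)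
  have h : milnorConnection G (Join.mk s) ∘ₗ pushforward Join.smooth_mk rfl = F := by
    -- A plot `P` of `S_G` is itself a lift of its image in `EG`.
    refine TSpace.hom_ext fun P hP hx v => ?_
    rw [LinearMap.comp_apply, pushforward_pushAt,
      milnorConnection_pushAt _ _ hP (.of_forall fun _ => rfl)]
    simp only [F, weightedForm, LinearMap.neg_apply, LinearMap.sum_apply, LinearMap.smul_apply,
      LinearMap.comp_apply, pushforward_pushAt, maurerCartan_pushAt]
  refine (LinearMap.congr_fun h v).trans ?_
  simp [F]

theorem smooth_milnorConnection :
    DSmooth (fun z : TBundle (EG G) => milnorConnection G z.1 z.2) := by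
  refine smooth_of_plotTangent _ fun {n p} hp {m} a v ha hv => ?_
  have hb : IsPlot fun u => milnorProj G (p (a u)) :=
    smooth_milnorProj _ _ (isPlot_reparam hp ha.contDiff)
  refine isPlot_of_eventuallyEq fun u₀ => ?_
  obtain ⟨r, hr, hrp⟩ := Join.exists_lift hp (a u₀)
  obtain ⟨k, hk⟩ := BG.exists_eventually_le_weightSum hb u₀
  refine ⟨_, isPlot_tSpace_neg <| isPlot_tSpace_sum (Finset.range k) fun i _ =>
    isPlot_tSpace_smul (BG.smooth_partition i _ _ hb) (isPlot_logDeriv (PreJoin.isPlot_pr hr i) ha hv),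
    ?_⟩
  -- Evaluating the form at `a u` needs the lift on a whole neighbourhood of `a u`, hence the
  -- iterated `eventually`.
  filter_upwards [hk, ha.contDiff.continuous.continuousAt.eventually
    (eventually_eventually_nhds.mpr hrp)] with u h1 h2
  have h3 : ∀ᶠ z in 𝓝 (0 : Euc n), Join.mk (r (a u + z)) = p (a u + z) := by
    have hc : Filter.Tendsto (fun z => a u + z) (𝓝 0) (𝓝 (a u)) := by
      have hc : Continuous fun z : Euc n => a u + z := continuous_const.add continuous_id
      simpa using hc.tendsto 0
    exact hc.eventually h2
  refine Eq.trans ?_ (milnorConnection_pushAt (PointedPlot.translate hp (a u)).isPlot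
    (PointedPlot.translate hp (a u)).map_zero
    (isPlot_reparam hr (contDiff_const.add contDiff_id)) h3 (v u)).symm
  rw [weightedForm_apply, BG.finsum_partition_smul h1]
  rfl

theorem isConnectionForm_milnorConnection :
    IsConnectionForm (isPrincipalBundle_milnorProj (G := G)) (milnorConnection G) where
  smooth := smooth_milnorConnection
  equivariant g y v := by
    have h : milnorConnection G (g • y) ∘ₗ
        pushforward ((isPrincipalBundle_milnorProj (G := G)).smooth_act g) rfl =
        Ad g ∘ₗ milnorConnection G y := by
      refine TSpace.hom_ext fun P hP hx v => ?_
      -- If `q` lifts `P`, its translate by `g` lifts `g • P`; the weights `φᵢ` are unchanged since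
      -- they live on `BG`.
      obtain ⟨q, hq, e⟩ := Join.exists_lift hP 0
      rw [LinearMap.comp_apply, LinearMap.comp_apply, pushforward_pushAt,
        milnorConnection_pushAt _ _ hq e,
        milnorConnection_pushAt _ _ (SG.isPlot_act isPlot_const hq)
          (e.mono fun z hz => by rw [← hz]; rfl), milnorProj_smul]
      simp only [weightedForm, LinearMap.neg_apply, LinearMap.sum_apply, LinearMap.smul_apply,
        map_neg, map_sum, map_smul, ← logDeriv_mul_right]
      rfl
    exact LinearMap.congr_fun h v
  fundamental y ξ := by
    obtain ⟨s, rfl⟩ : ∃ s : SG G, Join.mk s = y := Quotient.mk_surjective y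
    have h : milnorConnection G (Join.mk s) ∘ₗ
        fundamentalVector isPrincipalBundle_milnorProj (Join.mk s) = LinearMap.id := by
      refine TSpace.hom_ext fun P hP hx v => ?_
      have hq : IsPlot fun z => SG.act (P z) s := SG.isPlot_act hP isPlot_const
      rw [LinearMap.comp_apply, fundamentalVector, pushforward_pushAt,
        milnorConnection_pushAt _ _ hq (.of_forall fun z => (smul_mk (P z) s).symm),
        weightedForm_apply]
      -- The orbit plot lifts to one with coordinates `sᵢ P⁻¹`. The constant left factor drops out,
      -- so every index contributes the same vector.
      have hi (i : ℕ) : logDeriv (fun z => (SG.act (P z) s).pr i) (PreJoin.isPlot_pr hq i) v = -pushAt P hP hx v :=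
        (logDeriv_mul_left (IsPlot.inv hP) (s.pr i) v).trans (logDeriv_inv hP hx v)
      simp only [hi]
      have h1 := BG.finsum_partition (milnorProj G (Join.mk s))
      have h2 := BG.finsum_partition_smul (BG.le_weightSum_size (milnorProj G (Join.mk s)))
        fun _ => (1 : ℝ)
      simp only [smul_eq_mul, mul_one] at h2
      rw [BG.finsum_partition_smul (BG.le_weightSum_size _), ← Finset.sum_smul, ← h2, h1]
      simp
    exact LinearMap.congr_fun h ξ

end Connection

end MilnorDiffeology

end

theorem theoremt (G : Type*) [Group G] [DiffeologicalSpace G] [DiffeologicalGroup G] :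
    ∃ hπ : IsPrincipalBundle G (milnorProj G),
    ∃ ω : ∀ y : EG G, TSpace y →ₗ[ℝ] TSpace (1 : G),
      IsConnectionForm hπ ω ∧
      ∃ φ : ℕ → BG G → ℝ,
        (∀ i, DSmooth (φ i)) ∧ (∀ i b, 0 ≤ φ i b) ∧ (∀ b, ∑ᶠ i, φ i b = 1) ∧
        (∀ i (s : SG G), s.t i = 0 → φ i (milnorProj G (Join.mk s)) = 0) ∧
        ∀ (s : SG G) (v : TSpace s),
          ω (Join.mk s) (pushforward Join.smooth_mk rfl v) =
            -∑ᶠ i, φ i (milnorProj G (Join.mk s)) •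
              maurerCartan (s.pr i) (pushforward (PreJoin.smooth_pr i) rfl v) :=
  ⟨isPrincipalBundle_milnorProj, milnorConnection G, isConnectionForm_milnorConnection,
    BG.partition, BG.smooth_partition, BG.partition_nonneg, BG.finsum_partition,
    fun _ _ h => BG.partition_eq_zero h, milnorConnection_mk⟩
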